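/- Let $n,d\ge 1$ be integers and let $\mathbb F_q$ be a finite field of characteristic at least $d(d-1)+1$. Let $T$ be a finite nonempty set, let $\delta\in\mathbb R$, and let $H:T\to\mathbb F_q^n$ be a hitting set generator with density $1-\delta$ for $n$-variate polynomials of degree at most $2d-1$ over $\mathbb F_q$; that is, for every nonzero $P\in\mathbb F_q[z_1,\dots,z_n]$ of total degree at most $2d-1$, $$\Pr_{t\in T}\left[P(H(t))=0\right]\le\delta ,$$ where $t$ is uniform in $T$. Call a polynomial $f$ over a field $\mathbb F$ indecomposable over $\mathbb F$ if it is non-constant and cannot be written as $f=g(h)$ with $g\in\mathbb F[z]$ univariate of degree at least $2$ and $h$ a polynomial over $\mathbb F$ in the same variables as $f$. Let $f\in\mathbb F_q[x_1,\dots,x_n,y]$ be of total degree at most $d$ and indecomposable over $\mathbb F_q$. Choose $(r,s)\in T\times T$ uniformly at random, put $(a_1,\dots,a_n)=H(r)$ and $(b_1,\dots,b_n)=H(s)$, and let $$F=f(b_1x+a_1y,\dots,b_nx+a_ny,\,y)\in\mathbb F_q[x,y].$$ Then $$\Pr_{(r,s)\in T\times T}\left[F\text{ is indecomposable over }\mathbb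 F_q\right]\ \ge\ 1-2^{d-1}\delta .$$ -/

import Mathlib

open MvPolynomial

/-- Probability of the event `P` under the uniform distribution on a finite nonempty type `S`. -/
noncomputable def uniformPr (S : Type*) [Finite S] [Nonempty S] (P : S → Prop) : ℝ :=
  (Nat.card {s : S // P s} : ℝ) / (Nat.card S : ℝ)

/-- `H : T → Kⁿ` is a hitting set generator with density `1 - δ` for `n`-variate polynomials
of (total) degree at most `D` over the field `K`. -/
def IsHSG {K T : Type*} [Field K] [Finite T] [Nonempty T] {n : ℕ}
    (H : T → Fin n → K) (D : ℕ) (δ : ℝ) : Prop :=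
  ∀ f : MvPolynomial (Fin n) K, f ≠ 0 → f.totalDegree ≤ D →
    uniformPr T (fun t => eval (H t) f = 0) ≤ δ

/-- A polynomial is decomposable over `K` if it is `g(h)` for some `h` in the same polynomial
ring and some univariate `g` over `K` of degree at least two. -/
def IsDecomposable {K σ : Type*} [Field K] (f : MvPolynomial σ K) : Prop :=
  ∃ (g : Polynomial K) (h : MvPolynomial σ K), 2 ≤ g.natDegree ∧ f = Polynomial.aeval h g

/-- A polynomial is indecomposable over `K` if it is non-constant and not decomposable. -/
def IsIndecomposable {K σ : Type*} [Field K] (f : MvPolynomial σ K) : Prop :=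
  (∀ c : K, f ≠ C c) ∧ ¬ IsDecomposable f

/-- The ring `K[x₁, …, xₙ, y]`: the variable `xᵢ` is `X (some i)` and `y` is `X none`. -/
abbrev PolyXY (K : Type*) [Field K] (n : ℕ) : Type _ := MvPolynomial (Option (Fin n)) K

/-- The restriction `f(b₁ x + a₁ y, …, bₙ x + aₙ y, y)` in `K[x, y]`, where the two variables
of the target ring are `x = X 0` and `y = X 1`. -/
noncomputable def planeRestriction {K : Type*} [Field K] {n : ℕ} (a b : Fin n → K)
    (f : PolyXY K n) : MvPolynomial (Fin 2) K :=
  aeval (fun v : Option (Fin n) =>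
    match v with
    | some i => C (b i) * X 0 + C (a i) * X 1
    | none => X 1) f

/-! Let e be the total degree of f. If the top form of f does not vanish at (a, 1), then f(x + a y,
y) is, up to a scalar, monic of degree e in y; call it F. In a decomposition F = g(h) with deg g = r
and deg_y h = s, so that e = r s, an affine change of h makes h monic with F - h^r of degree below
(r - 1) s: h is the approximate r-th root of F. For r invertible in K this root is unique, and it
already exists over K[x₁, …, xₙ], so restricting x to the line through b carries the generic root H
to the root on the plane.

Moreover F is a polynomial in a monic h exactly when all digits of its h-adic expansion lie in K. As
f is indecomposable, some H-adic digit of F is not constant. Digits have total degree at most e, so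
a nonzero polynomial in b of degree at most e certifies that this digit stays nonconstant on the
plane, which excludes inner degree s (`exists_eval_ne_zero_imp_inner_degree_ne`). One bad event for
a and at most one for each s in 1, …, e - 1 give failure probability at most e δ ≤ 2^(d-1) δ. -/

/-! ### Adic expansions and approximate roots -/

section ApproximateRoot

variable {K A : Type*} [Field K] [CommRing A] [Algebra K A]

/-- The `i`-th digit of the `h`-adic expansion of `F`. -/
noncomputable def adicDigit {A : Type*} [CommRing A] (h F : Polynomial A) (i : ℕ) :
    Polynomial A :=
  ((fun P => P /ₘ h)^[i] F) %ₘ h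

theorem adicDigit_zero {A : Type*} [CommRing A] (h F : Polynomial A) :
    adicDigit h F 0 = F %ₘ h := rfl

theorem adicDigit_succ {A : Type*} [CommRing A] (h F : Polynomial A) (i : ℕ) :
    adicDigit h F (i + 1) = adicDigit h (F /ₘ h) i := rfl

theorem map_adicDigit {A B : Type*} [CommRing A] [CommRing B] (φ : A →+* B) {h : Polynomial A}
    (hh : h.Monic) (F : Polynomial A) (i : ℕ) :
    (adicDigit h F i).map φ = adicDigit (h.map φ) (F.map φ) i := by
  induction i generalizing F with
  | zero => rw [adicDigit_zero, adicDigit_zero, Polynomial.map_modByMonic _ hh]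
  | succ i ih => rw [adicDigit_succ, adicDigit_succ, ih, Polynomial.map_divByMonic _ hh]

/-- Writing g = z g' + g(0) gives g(h) = h g'(h) + g(0), which is already a division with remainder
by h. -/
theorem aeval_divModByMonic {h : Polynomial A} (hh : h.Monic) (hs : 0 < h.natDegree)
    (g : Polynomial K) :
    Polynomial.aeval h g /ₘ h = Polynomial.aeval h g.divX ∧
      Polynomial.aeval h g %ₘ h = algebraMap K (Polynomial A) (g.coeff 0) := by
  apply Polynomial.div_modByMonic_unique _ _ hh
  constructor
  · conv_rhs => rw [← Polynomial.divX_mul_X_add g]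
    simp
    ring
  · rw [IsScalarTower.algebraMap_apply K A (Polynomial A)]
    refine lt_of_le_of_lt Polynomial.degree_C_le ?_
    exact Polynomial.natDegree_pos_iff_degree_pos.mp hs

theorem adicDigit_aeval {h : Polynomial A} (hh : h.Monic) (hs : 0 < h.natDegree)
    (g : Polynomial K) (i : ℕ) :
    ∃ c : K, adicDigit h (Polynomial.aeval h g) i = algebraMap K (Polynomial A) c := by
  induction i generalizing g with
  | zero => exact ⟨_, (aeval_divModByMonic hh hs g).2⟩
  | succ i ih => rw [adicDigit_succ, (aeval_divModByMonic hh hs g).1]; exact ih _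

/-- Each of the r summands is monic of degree (r - 1) s. This cofactor of h₁ - h₂ in h₁^r - h₂^r
drives both uniqueness and existence of approximate roots. -/
theorem coeff_geomSum_of_monic (r : ℕ) {s : ℕ} {h₁ h₂ : Polynomial A} (m₁ : h₁.Monic)
    (m₂ : h₂.Monic) (d₁ : h₁.natDegree = s) (d₂ : h₂.natDegree = s) :
    (∑ i ∈ Finset.range r, h₁ ^ i * h₂ ^ (r - 1 - i)).coeff ((r - 1) * s) = r := by
  rw [Polynomial.finsetSum_coeff]
  rw [Finset.sum_congr rfl (g := fun _ => (1 : A)) ?_]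
  · simp
  · intro i hi
    have hi' : i ≤ r - 1 := by have := Finset.mem_range.1 hi; omega
    have hm : (h₁ ^ i * h₂ ^ (r - 1 - i)).Monic := (m₁.pow i).mul (m₂.pow _)
    have hd : (h₁ ^ i * h₂ ^ (r - 1 - i)).natDegree = (r - 1) * s := by
      rw [(m₁.pow i).natDegree_mul (m₂.pow _), m₁.natDegree_pow, m₂.natDegree_pow, d₁, d₂,
        ← add_mul, Nat.add_sub_cancel' hi']
    rw [← hd]; exact hm

theorem natDegree_geomSum_le (r : ℕ) {s : ℕ} {h₁ h₂ : Polynomial A}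
    (d₁ : h₁.natDegree ≤ s) (d₂ : h₂.natDegree ≤ s) :
    (∑ i ∈ Finset.range r, h₁ ^ i * h₂ ^ (r - 1 - i)).natDegree ≤ (r - 1) * s := by
  refine Polynomial.natDegree_sum_le_of_forall_le _ _ fun i hi => ?_
  have hi' : i ≤ r - 1 := by have := Finset.mem_range.1 hi; omega
  refine (Polynomial.natDegree_mul_le_of_le (Polynomial.natDegree_pow_le_of_le i d₁)
    (Polynomial.natDegree_pow_le_of_le _ d₂)).trans ?_
  rw [← add_mul, Nat.add_sub_cancel' hi']

variable [IsDomain A]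

/-- The digits are the coefficients of g; induction on the degree, passing to the quotient by h.
Converse of `adicDigit_aeval`. -/
theorem exists_eq_aeval_of_adicDigit {h : Polynomial A} (hh : h.Monic) (hs : 0 < h.natDegree)
    (F : Polynomial A)
    (hF : ∀ i, ∃ c : K, adicDigit h F i = algebraMap K (Polynomial A) c) :
    ∃ g : Polynomial K, F = Polynomial.aeval h g := by
  induction hN : F.natDegree using Nat.strong_induction_on generalizing F with
  | _ N ih =>
    obtain ⟨c, hc⟩ := hF 0
    rw [adicDigit_zero] at hc
    rcases Nat.eq_zero_or_pos N with h0 | h0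
    · refine ⟨Polynomial.C c, ?_⟩
      rw [Polynomial.aeval_C, ← hc, (Polynomial.modByMonic_eq_self_iff hh).2]
      exact Polynomial.degree_lt_degree (by omega)
    · obtain ⟨g, hg⟩ := ih (F /ₘ h).natDegree
        (by rw [Polynomial.natDegree_divByMonic _ hh]; omega) (F /ₘ h)
        (fun i => hF (i + 1)) rfl
      refine ⟨Polynomial.C c + Polynomial.X * g, ?_⟩
      rw [← Polynomial.modByMonic_add_div F h, hc, hg]
      simp

/-- Uniqueness of the approximate root. -/
theorem approximateRoot_unique {r s : ℕ} (hrA : (r : A) ≠ 0)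
    {P h₁ h₂ : Polynomial A} (m₁ : h₁.Monic) (m₂ : h₂.Monic)
    (d₁ : h₁.natDegree = s) (d₂ : h₂.natDegree = s)
    (e₁ : (P - h₁ ^ r).degree < ((r - 1) * s : ℕ)) (e₂ : (P - h₂ ^ r).degree < ((r - 1) * s : ℕ)) :
    h₁ = h₂ := by
  by_contra hne
  have hlt : (h₁ ^ r - h₂ ^ r).degree < ((r - 1) * s : ℕ) := by
    have : h₁ ^ r - h₂ ^ r = (P - h₂ ^ r) - (P - h₁ ^ r) := by ring
    rw [this]
    exact lt_of_le_of_lt (Polynomial.degree_sub_le _ _) (max_lt e₂ e₁)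
  -- A nonzero h₁ - h₂ times a cofactor of degree at least (r - 1) s cannot have degree below (r -
  -- 1) s in a domain.
  have hc := coeff_geomSum_of_monic r m₁ m₂ d₁ d₂
  have hS : (((r - 1) * s : ℕ) : WithBot ℕ) ≤
      (∑ i ∈ Finset.range r, h₁ ^ i * h₂ ^ (r - 1 - i)).degree :=
    Polynomial.le_degree_of_ne_zero (by rw [hc]; exact hrA)
  rw [← Commute.mul_geom_sum₂ (Commute.all h₁ h₂), Polynomial.degree_mul] at hlt
  have h0 : 0 ≤ (h₁ - h₂).degree :=
    Polynomial.zero_le_degree_iff.2 (sub_ne_zero.2 hne)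
  exact absurd hlt (not_lt.2 (le_trans hS (le_add_of_nonneg_left h0)))

theorem aeval_eq_map_comp {A : Type*} [CommRing A] [Algebra K A] (h : Polynomial A)
    (g : Polynomial K) : Polynomial.aeval h g = (g.map (algebraMap K A)).comp h := by
  rw [Polynomial.comp, Polynomial.eval₂_map, Polynomial.aeval_def]
  rfl

theorem natDegree_aeval (h : Polynomial A) (g : Polynomial K) :
    (Polynomial.aeval h g).natDegree = g.natDegree * h.natDegree := by
  rw [aeval_eq_map_comp, Polynomial.natDegree_comp, Polynomial.natDegree_map]

/-- A monic decomposable polynomial over `A` has, after an affine change of the inner polynomial,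
an approximate root as inner polynomial. -/
theorem exists_normalized_decomposition
    (hunit : ∀ a : A, IsUnit a → ∃ c : K, a = algebraMap K A c)
    {F h : Polynomial A} {g : Polynomial K} (hF : F.Monic) (hFd : 0 < F.natDegree)
    (hg : 2 ≤ g.natDegree) (hr : (g.natDegree : K) ≠ 0) (hFg : F = Polynomial.aeval h g) :
    F.natDegree = g.natDegree * h.natDegree ∧
    ∃ (h₁ : Polynomial A) (g₁ : Polynomial K), h₁.Monic ∧ h₁.natDegree = h.natDegree ∧
      F = Polynomial.aeval h₁ g₁ ∧
      (F - h₁ ^ g.natDegree).degree < ((g.natDegree - 1) * h.natDegree : ℕ) := by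
  have hinj : Function.Injective (algebraMap K A) := (algebraMap K A).injective
  have hdeg := natDegree_aeval h g
  rw [← hFg] at hdeg
  have hspos : 0 < h.natDegree := by
    rcases Nat.eq_zero_or_pos h.natDegree with h0 | h0
    · rw [h0] at hdeg; omega
    · exact h0
  have hlc : 1 = algebraMap K A g.leadingCoeff * h.leadingCoeff ^ g.natDegree := by
    rw [← hF.leadingCoeff, hFg, aeval_eq_map_comp, Polynomial.leadingCoeff_comp hspos.ne',
      Polynomial.leadingCoeff_map, Polynomial.natDegree_map]
  obtain ⟨r, hrg⟩ : ∃ r, g.natDegree = r + 1 := ⟨g.natDegree - 1, by omega⟩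
  -- Monicity of F makes the leading coefficient of h a unit of A, hence a constant u in K.
  have hu : IsUnit h.leadingCoeff := by
    refine IsUnit.of_mul_eq_one (algebraMap K A g.leadingCoeff * h.leadingCoeff ^ r) ?_
    rw [hlc, hrg]; ring
  obtain ⟨u, hu'⟩ := hunit _ hu
  have hu0 : u ≠ 0 := by
    rintro rfl
    rw [hu', map_zero] at hu
    exact not_isUnit_zero hu
  have hlcK : g.leadingCoeff * u ^ g.natDegree = 1 := by
    apply hinj
    rw [map_mul, map_pow, ← hu', ← hlc, map_one]
  refine ⟨hdeg, ?_⟩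
  -- `ℓ = u⁻¹ z + v` is the affine change of the inner polynomial.
  let v : K := g.coeff r * u ^ r / g.natDegree
  let l : Polynomial K := Polynomial.C u⁻¹ * Polynomial.X + Polynomial.C v
  let m : Polynomial K := Polynomial.C u * Polynomial.X - Polynomial.C (u * v)
  have hml : m.comp l = Polynomial.X := by
    simp only [m, l, Polynomial.sub_comp, Polynomial.mul_comp, Polynomial.C_comp,
      Polynomial.X_comp, mul_add, ← mul_assoc, ← Polynomial.C_mul, mul_inv_cancel₀ hu0]
    simp
  have hl1 : l.natDegree = 1 := by
    simp only [l]; exact Polynomial.natDegree_linear (inv_ne_zero hu0)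
  have hllc : l.leadingCoeff = u⁻¹ := by
    rw [Polynomial.leadingCoeff, hl1]; simp [l]
  refine ⟨Polynomial.aeval h l, g.comp m, ?_, ?_, ?_, ?_⟩
  · rw [Polynomial.Monic, aeval_eq_map_comp, Polynomial.leadingCoeff_comp hspos.ne',
      Polynomial.leadingCoeff_map, Polynomial.natDegree_map, hl1, hllc, hu', pow_one, ← map_mul,
      inv_mul_cancel₀ hu0, map_one]
  · rw [natDegree_aeval, hl1, one_mul]
  · rw [Polynomial.aeval_comp, ← Polynomial.aeval_comp h (p := m) (q := l), hml,
      Polynomial.aeval_X, hFg]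
  -- g and ℓ^(r+1) share their two top coefficients: the leading one by `hlcK`, the next by the
  -- choice of v, which needs division by deg g = r + 1.
  · have hG : (g - l ^ g.natDegree).degree < (r : ℕ) := by
      rw [Polynomial.degree_lt_iff_coeff_zero]
      intro i hi
      rw [Polynomial.coeff_sub, sub_eq_zero]
      have hle : l = Polynomial.C u⁻¹ * (Polynomial.X + Polynomial.C (u * v)) := by
        simp only [l, mul_add, ← Polynomial.C_mul, inv_mul_cancel_left₀ hu0]
      rcases lt_trichotomy i (r + 1) with h1 | h1 | h1
      · have : i = r := by omega
        subst this
        rw [hle, mul_pow, ← Polynomial.C_pow, Polynomial.coeff_C_mul,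
          Polynomial.coeff_X_add_C_pow, hrg, Nat.add_sub_cancel_left, Nat.choose_succ_self_right]
        simp only [v, hrg]
        rw [hrg] at hr
        rw [inv_pow, pow_succ]
        field_simp
      · subst h1
        rw [hle, mul_pow, ← Polynomial.C_pow, Polynomial.coeff_C_mul,
          Polynomial.coeff_X_add_C_pow, hrg, Nat.sub_self, pow_zero, Nat.choose_self, Nat.cast_one,
          mul_one, mul_one, ← hrg, inv_pow]
        exact eq_inv_of_mul_eq_one_left hlcK
      · rw [Polynomial.coeff_eq_zero_of_natDegree_lt (by omega),
          Polynomial.coeff_eq_zero_of_natDegree_lt (by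
            rw [Polynomial.natDegree_pow, hl1]; omega)]
    have : F - Polynomial.aeval h l ^ g.natDegree = Polynomial.aeval h (g - l ^ g.natDegree) := by
      rw [map_sub, map_pow, hFg]
    rw [this]
    by_cases h0 : Polynomial.aeval h (g - l ^ g.natDegree) = 0
    · rw [h0, Polynomial.degree_zero]; exact WithBot.bot_lt_coe _
    · rw [Polynomial.degree_eq_natDegree h0, natDegree_aeval, hrg]
      rw [Nat.cast_lt, Nat.add_sub_cancel]
      refine Nat.mul_lt_mul_of_pos_right ?_ hspos
      rw [← hrg]
      refine (Polynomial.natDegree_lt_iff_degree_lt ?_).2 hG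
      rintro h1; rw [h1, map_zero] at h0; exact h0 rfl

end ApproximateRoot

/-! ### Total degree bounds for digits and approximate roots -/

section TotalDegree

variable {K σ : Type*} [Field K]

/-- The total degree of a univariate polynomial over `K[σ]`, the new variable included. -/
noncomputable def jointDegree (P : Polynomial (MvPolynomial σ K)) : ℕ :=
  ((optionEquivLeft K σ).symm P).totalDegree

theorem jointDegree_mul_le (P Q : Polynomial (MvPolynomial σ K)) :
    jointDegree (P * Q) ≤ jointDegree P + jointDegree Q := by
  rw [jointDegree, map_mul]; exact totalDegree_mul _ _

theorem jointDegree_pow_le (P : Polynomial (MvPolynomial σ K)) (r : ℕ) :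
    jointDegree (P ^ r) ≤ r * jointDegree P := by
  rw [jointDegree, map_pow]; exact totalDegree_pow _ _

theorem jointDegree_add_le (P Q : Polynomial (MvPolynomial σ K)) :
    jointDegree (P + Q) ≤ max (jointDegree P) (jointDegree Q) := by
  rw [jointDegree, map_add]; exact totalDegree_add _ _

theorem jointDegree_sub_le (P Q : Polynomial (MvPolynomial σ K)) :
    jointDegree (P - Q) ≤ max (jointDegree P) (jointDegree Q) := by
  rw [jointDegree, map_sub]; exact totalDegree_sub _ _

theorem jointDegree_X_pow_le (j : ℕ) :
    jointDegree (Polynomial.X ^ j : Polynomial (MvPolynomial σ K)) ≤ j := by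
  refine (jointDegree_pow_le _ _).trans ?_
  rw [jointDegree, optionEquivLeft_symm_X, totalDegree_X, mul_one]

theorem jointDegree_C_le (q : MvPolynomial σ K) :
    jointDegree (Polynomial.C q) ≤ q.totalDegree := by
  have h : (optionEquivLeft K σ).symm (Polynomial.C q) = rename some q := by
    rw [AlgEquiv.symm_apply_eq]
    induction q using MvPolynomial.induction_on with
    | C a => simp
    | add p q hp hq => simp [hp, hq]
    | mul_X p i hp => simp [hp]
  rw [jointDegree, h]
  exact totalDegree_rename_le _ _

theorem totalDegree_coeff_add_le_jointDegree (P : Polynomial (MvPolynomial σ K)) {j : ℕ}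
    (hj : P.coeff j ≠ 0) : (P.coeff j).totalDegree + j ≤ jointDegree P := by
  have hdeg : j ≤ ((optionEquivLeft K σ).symm P).totalDegree := by
    refine (Polynomial.le_natDegree_of_ne_zero hj).trans ?_
    have h := natDegree_optionEquivLeft K ((optionEquivLeft K σ).symm P)
    rw [AlgEquiv.apply_symm_apply] at h
    rw [h]
    exact degreeOf_le_totalDegree _ _
  have h := totalDegree_coeff_optionEquivLeft_add_le K σ ((optionEquivLeft K σ).symm P) j hdeg
  rwa [AlgEquiv.apply_symm_apply] at h

theorem jointDegree_C_mul_X_pow_le (q : MvPolynomial σ K) (j : ℕ) :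
    jointDegree (Polynomial.C q * Polynomial.X ^ j) ≤ q.totalDegree + j :=
  (jointDegree_mul_le _ _).trans (add_le_add (jointDegree_C_le _) (jointDegree_X_pow_le _))

/-- When h is monic with total degree equal to its degree in the main variable, cancelling a leading
term by a multiple of h never raises the total degree. -/
theorem jointDegree_divModByMonic_le {h : Polynomial (MvPolynomial σ K)} (hh : h.Monic)
    (hs : jointDegree h ≤ h.natDegree) {D : ℕ} (P : Polynomial (MvPolynomial σ K))
    (hP : jointDegree P ≤ D) :
    jointDegree (P /ₘ h) ≤ D ∧ jointDegree (P %ₘ h) ≤ D := by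
  suffices H : ∃ Q R : Polynomial (MvPolynomial σ K), R + h * Q = P ∧ R.degree < h.degree ∧
      jointDegree Q ≤ D ∧ jointDegree R ≤ D by
    obtain ⟨Q, R, h1, h2, h3, h4⟩ := H
    obtain ⟨rfl, rfl⟩ := Polynomial.div_modByMonic_unique Q R hh ⟨h1, h2⟩
    exact ⟨h3, h4⟩
  induction hN : P.degree using WellFoundedLT.induction generalizing P with
  | _ N ih =>
    by_cases hlt : P.degree < h.degree
    · exact ⟨0, P, by simp, hlt, by simp [jointDegree], hP⟩
    · have hle : h.degree ≤ P.degree := not_lt.1 hlt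
      have hP0 : P ≠ 0 := by
        rintro rfl
        rw [Polynomial.degree_zero, le_bot_iff, Polynomial.degree_eq_bot] at hle
        exact hh.ne_zero hle
      have hle' : h.natDegree ≤ P.natDegree := Polynomial.natDegree_le_natDegree hle
      have hc := totalDegree_coeff_add_le_jointDegree P (j := P.natDegree)
        (by rw [Polynomial.coeff_natDegree]; exact Polynomial.leadingCoeff_ne_zero.2 hP0)
      rw [Polynomial.coeff_natDegree] at hc
      let T := Polynomial.C P.leadingCoeff * Polynomial.X ^ (P.natDegree - h.natDegree)
      have hT : jointDegree T ≤ P.leadingCoeff.totalDegree + (P.natDegree - h.natDegree) :=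
        jointDegree_C_mul_X_pow_le _ _
      have hhT := jointDegree_mul_le h T
      obtain ⟨Q, R, h1, h2, h3, h4⟩ := ih (P - h * T).degree
        (by rw [← hN]; exact Polynomial.div_wf_lemma ⟨hle, hP0⟩ hh) (P - h * T)
        ((jointDegree_sub_le _ _).trans (max_le hP (by omega))) rfl
      exact ⟨Q + T, R, by rw [mul_add, ← add_assoc, h1]; ring, h2,
        (jointDegree_add_le _ _).trans (max_le h3 (by omega)), h4⟩

theorem jointDegree_adicDigit_le {h : Polynomial (MvPolynomial σ K)} (hh : h.Monic)
    (hs : jointDegree h ≤ h.natDegree) {D : ℕ} (P : Polynomial (MvPolynomial σ K))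
    (hP : jointDegree P ≤ D) (i : ℕ) : jointDegree (adicDigit h P i) ≤ D := by
  induction i generalizing P with
  | zero => exact (jointDegree_divModByMonic_le hh hs P hP).2
  | succ i ih => exact ih _ (jointDegree_divModByMonic_le hh hs P hP).1

/-- Existence of the approximate root, with control of the total degree. -/
theorem exists_approximateRoot {r s : ℕ} (hr : 0 < r) (hrK : (r : K) ≠ 0)
    {P : Polynomial (MvPolynomial σ K)} (hP : P.Monic) (hPd : P.natDegree = r * s)
    (hPj : jointDegree P ≤ r * s) :
    ∃ h : Polynomial (MvPolynomial σ K), h.Monic ∧ h.natDegree = s ∧ jointDegree h ≤ s ∧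
      (P - h ^ r).degree < ((r - 1) * s : ℕ) := by
  suffices H : ∀ i ≤ s, ∃ h : Polynomial (MvPolynomial σ K), h.Monic ∧ h.natDegree = s ∧
      jointDegree h ≤ s ∧ (P - h ^ r).degree < (r * s - i : ℕ) by
    obtain ⟨h, h1, h2, h3, h4⟩ := H s le_rfl
    refine ⟨h, h1, h2, h3, ?_⟩
    rwa [Nat.sub_mul, one_mul]
  intro i
  induction i with
  | zero =>
    intro _
    refine ⟨Polynomial.X ^ s, Polynomial.monic_X_pow s, Polynomial.natDegree_X_pow s,
      jointDegree_X_pow_le s, ?_⟩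
    have hd : P.degree = (r * s : ℕ) := by
      rw [Polynomial.degree_eq_natDegree hP.ne_zero, hPd]
    rw [Nat.sub_zero, ← hd]
    refine Polynomial.degree_sub_lt_left ?_ hP.ne_zero ?_
    · rw [hd, ← pow_mul, Polynomial.degree_X_pow, mul_comm]
    · rw [hP.leadingCoeff, ← pow_mul, (Polynomial.monic_X_pow _).leadingCoeff]
  | succ i ih =>
    intro hi
    obtain ⟨h, h1, h2, h3, h4⟩ := ih (by omega)
    have hrs : s ≤ r * s := Nat.le_mul_of_pos_left s hr
    -- Adding T to h changes h^r by T times a cofactor with top coefficient r, so dividing q by r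
    -- cancels the coefficient at r s - (i + 1). The total degree of q is at most i + 1, hence that
    -- of T is at most s.
    let q := (P - h ^ r).coeff (r * s - (i + 1))
    let T := Polynomial.C (q * C (r : K)⁻¹) * Polynomial.X ^ (s - (i + 1))
    have hTdeg : T.degree ≤ (s - (i + 1) : ℕ) := Polynomial.degree_C_mul_X_pow_le _ _
    have hdegh : h.degree = s := by rw [Polynomial.degree_eq_natDegree h1.ne_zero, h2]
    have hTh : T.degree < h.degree := by
      rw [hdegh]; refine lt_of_le_of_lt hTdeg ?_; exact_mod_cast (by omega)
    have hTj : jointDegree T ≤ s := by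
      by_cases hq : q = 0
      · simp [T, hq, jointDegree]
      · have hb := totalDegree_coeff_add_le_jointDegree (P - h ^ r) hq
        have hb2 : jointDegree (P - h ^ r) ≤ r * s :=
          (jointDegree_sub_le _ _).trans (max_le hPj ((jointDegree_pow_le _ _).trans (by gcongr)))
        have hb3 : jointDegree T ≤ (q * C (r : K)⁻¹).totalDegree + (s - (i + 1)) :=
          jointDegree_C_mul_X_pow_le _ _
        have hb4 := totalDegree_mul q (C (r : K)⁻¹)
        rw [totalDegree_C] at hb4
        change q.totalDegree + _ ≤ _ at hb
        omega
    refine ⟨h + T, h1.add_of_left hTh, ?_, (jointDegree_add_le _ _).trans (max_le h3 hTj), ?_⟩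
    · rw [Polynomial.natDegree_add_eq_left_of_degree_lt hTh, h2]
    · have hTm : (h + T).Monic := h1.add_of_left hTh
      have hTd : (h + T).natDegree = s := by
        rw [Polynomial.natDegree_add_eq_left_of_degree_lt hTh, h2]
      have hN : r * s - (i + 1) = (s - (i + 1)) + (r - 1) * s := by
        rw [Nat.sub_mul, one_mul]; omega
      have hS := natDegree_geomSum_le r hTd.le h2.le
      have hSc := coeff_geomSum_of_monic r hTm h1 hTd h2
      have hpow : P - (h + T) ^ r = (P - h ^ r) -
          T * ∑ i ∈ Finset.range r, (h + T) ^ i * h ^ (r - 1 - i) := by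
        have hg := Commute.mul_geom_sum₂ (Commute.all (h + T) h) r
        rw [add_sub_cancel_left] at hg
        rw [hg]; ring
      have hTnd : T.natDegree ≤ s - (i + 1) := Polynomial.natDegree_C_mul_X_pow_le _ _
      rw [hpow, Polynomial.degree_lt_iff_coeff_zero]
      rw [Polynomial.degree_lt_iff_coeff_zero] at h4
      intro j hj
      rw [Polynomial.coeff_sub]
      rcases hj.eq_or_lt with rfl | hj
      · have hcT : T.coeff (s - (i + 1)) = q * C (r : K)⁻¹ := by
          rw [Polynomial.coeff_C_mul, Polynomial.coeff_X_pow_self, mul_one]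
        have hrC : (C (r : K)⁻¹ : MvPolynomial σ K) * r = 1 := by
          rw [← map_natCast (C : K →+* MvPolynomial σ K), ← C_mul, inv_mul_cancel₀ hrK, C_1]
        conv_lhs => rw [hN, Polynomial.coeff_mul_add_eq_of_natDegree_le hTnd hS, hSc, hcT,
          mul_assoc, hrC, mul_one, ← hN]
        exact sub_self _
      · rw [h4 j (by omega), Polynomial.coeff_eq_zero_of_natDegree_lt, sub_zero]
        refine lt_of_le_of_lt (Polynomial.natDegree_mul_le_of_le hTnd hS) (by omega)

end TotalDegree

/-! ### The shear and its leading coefficient -/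

section Shear

variable {K σ : Type*} [Field K]

theorem totalDegree_aeval_le_of_linear {τ : Type*} (φ : σ → MvPolynomial τ K)
    (hφ : ∀ i, (φ i).totalDegree ≤ 1) (f : MvPolynomial σ K) :
    (aeval φ f).totalDegree ≤ f.totalDegree := by
  rw [aeval_def, eval₂_eq]
  refine totalDegree_finsetSum_le fun m hm => (totalDegree_mul _ _).trans ?_
  rw [algebraMap_eq, totalDegree_C, zero_add]
  refine le_trans ?_ (le_totalDegree hm)
  refine (totalDegree_finsetProd _ _).trans (Finset.sum_le_sum fun i _ => ?_)
  exact (totalDegree_pow _ _).trans (by simpa using Nat.mul_le_mul_left (m i) (hφ i))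

/-- The ring homomorphism `f ↦ f(x + a y, y)`. -/
noncomputable def shear (a : σ → K) :
    MvPolynomial (Option σ) K →ₐ[K] Polynomial (MvPolynomial σ K) :=
  aeval fun v => v.elim Polynomial.X
    fun i => Polynomial.C (X i) + Polynomial.C (C (a i)) * Polynomial.X

theorem jointDegree_shear_le (a : σ → K) (f : MvPolynomial (Option σ) K) :
    jointDegree (shear a f) ≤ f.totalDegree := by
  have h : (optionEquivLeft K σ).symm (shear a f) =
      aeval (fun v : Option σ => v.elim (X none) fun i => X (some i) + C (a i) * X none) f := by
    have : (optionEquivLeft K σ).symm.toAlgHom.comp (shear a) = aeval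
        (fun v : Option σ => v.elim (X none) fun i => X (some i) + C (a i) * X none) := by
      ext v : 1
      cases v <;> simp [shear]
    exact DFunLike.congr_fun this f
  rw [jointDegree, h]
  refine totalDegree_aeval_le_of_linear _ (fun v => ?_) f
  cases v with
  | none => simp
  | some i =>
    refine (totalDegree_add _ _).trans (max_le (by simp) ((totalDegree_mul _ _).trans ?_))
    simp

theorem natDegree_shear_le (a : σ → K) (f : MvPolynomial (Option σ) K) :
    (shear a f).natDegree ≤ f.totalDegree := by
  rw [Polynomial.natDegree_le_iff_coeff_eq_zero]
  intro j hj
  by_contra h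
  have := totalDegree_coeff_add_le_jointDegree _ h
  have := jointDegree_shear_le a f
  omega

/-- The substitution x ↦ x - a y undoes the shear and carries the decomposition back to f. -/
theorem isDecomposable_of_shear {a : σ → K} {f : MvPolynomial (Option σ) K}
    {h : Polynomial (MvPolynomial σ K)} {g : Polynomial K} (hg : 2 ≤ g.natDegree)
    (hf : shear a f = Polynomial.aeval h g) : IsDecomposable f := by
  let τ : Polynomial (MvPolynomial σ K) →ₐ[K] MvPolynomial (Option σ) K :=
    (aeval fun v : Option σ => v.elim (X none) fun i => X (some i) - C (a i) * X none).comp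
      (optionEquivLeft K σ).symm.toAlgHom
  have hτ : τ.comp (shear a) = AlgHom.id K _ := by
    ext v : 1
    cases v <;> simp [shear, τ]
  refine ⟨g, τ h, hg, ?_⟩
  rw [Polynomial.aeval_algHom_apply, ← hf]
  exact (DFunLike.congr_fun hτ f).symm

theorem coeff_aeval_C_mul_X (a : σ → K) (f : MvPolynomial σ K) (e : ℕ) :
    (aeval (fun v => Polynomial.C (a v) * Polynomial.X) f).coeff e =
      eval a (homogeneousComponent e f) := by
  induction f using MvPolynomial.induction_on' with
  | monomial m c =>
    have h1 : aeval (fun v => Polynomial.C (a v) * Polynomial.X) (monomial m c) =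
        Polynomial.C (eval a (monomial m c)) * Polynomial.X ^ m.degree := by
      rw [aeval_monomial, eval_monomial]
      simp only [Finsupp.prod, mul_pow, Finset.prod_mul_distrib, Finset.prod_pow_eq_pow_sum,
        Polynomial.C_mul, map_prod, Polynomial.C_pow, Polynomial.algebraMap_eq, mul_assoc]
      rfl
    rw [h1, Polynomial.coeff_C_mul, Polynomial.coeff_X_pow,
      homogeneousComponent_of_mem (isHomogeneous_monomial c rfl)]
    split_ifs <;> simp
  | add p q hp hq => simp only [map_add, Polynomial.coeff_add, hp, hq]

/-- The top homogeneous component of `f`, with the last variable set to one. -/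
noncomputable def dehomogenizedTop (f : MvPolynomial (Option σ) K) : MvPolynomial σ K :=
  aeval (fun v : Option σ => v.elim 1 X) (homogeneousComponent f.totalDegree f)

theorem totalDegree_dehomogenizedTop_le (f : MvPolynomial (Option σ) K) :
    (dehomogenizedTop f).totalDegree ≤ f.totalDegree := by
  refine (totalDegree_aeval_le_of_linear _ (fun v => ?_) _).trans
    (homogeneousComponent_isHomogeneous _ f).totalDegree_le
  cases v <;> simp

theorem degree_eq_none_add_degree_some (m : Option σ →₀ ℕ) :
    m.degree = m none + m.some.degree := by
  have h := m.sum_option_index (fun _ k => k) (fun _ => rfl) (fun _ _ _ => rfl)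
  exact h

/-- No cancellation occurs: in a form of degree e the exponent of the last variable is determined by
the others. -/
theorem IsHomogeneous.aeval_option_elim_ne_zero {p : MvPolynomial (Option σ) K} {e : ℕ}
    (hp : p.IsHomogeneous e) (h0 : p ≠ 0) :
    aeval (fun v : Option σ => v.elim (1 : MvPolynomial σ K) X) p ≠ 0 := by
  classical
  have hsum : aeval (fun v : Option σ => v.elim (1 : MvPolynomial σ K) X) p =
      ∑ m ∈ p.support, monomial m.some (coeff m p) := by
    conv_lhs => rw [p.as_sum, map_sum]
    refine Finset.sum_congr rfl fun m _ => ?_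
    rw [aeval_monomial, Finsupp.prod_option_index _ _ (by simp) (by simp [pow_add]),
      monomial_eq]
    simp
  obtain ⟨m, hm⟩ := support_nonempty.2 h0
  rw [hsum]
  intro hz
  have hc := congrArg (coeff m.some) hz
  rw [coeff_sum, coeff_zero, Finset.sum_eq_single_of_mem m hm, coeff_monomial, if_pos rfl] at hc
  · exact mem_support_iff.1 hm hc
  · intro m' hm' hne
    rw [coeff_monomial, if_neg]
    intro hsome
    apply hne
    have d1 := hp (mem_support_iff.1 hm)
    have d2 := (hp (mem_support_iff.1 hm')).trans d1.symm
    change Finsupp.weight (fun _ => 1) m' = Finsupp.weight (fun _ => 1) m at d2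
    rw [← Finsupp.degree_eq_weight_one, degree_eq_none_add_degree_some,
      degree_eq_none_add_degree_some, hsome] at d2
    ext v
    cases v with
    | none => omega
    | some i => exact DFunLike.congr_fun hsome i

theorem dehomogenizedTop_ne_zero {f : MvPolynomial (Option σ) K} (hf : f ≠ 0) :
    dehomogenizedTop f ≠ 0 := by
  refine IsHomogeneous.aeval_option_elim_ne_zero (homogeneousComponent_isHomogeneous _ f) ?_
  obtain ⟨m, hm, hdeg⟩ := Finset.exists_mem_eq_sup f.support (support_nonempty.2 hf)
    fun m => m.sum fun _ k => k
  intro h0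
  have hc := congrArg (coeff m) h0
  rw [coeff_homogeneousComponent, if_pos (show m.degree = f.totalDegree from hdeg.symm),
    coeff_zero] at hc
  exact mem_support_iff.1 hm hc

/-- The total degree bound forces this coefficient to be constant, so it may be read off at x = 0,
where the sheared polynomial is f(a y, y). -/
theorem coeff_shear_totalDegree (a : σ → K) (f : MvPolynomial (Option σ) K) :
    (shear a f).coeff f.totalDegree = C (eval a (dehomogenizedTop f)) := by
  have hconst : (shear a f).coeff f.totalDegree =
      C (eval 0 ((shear a f).coeff f.totalDegree)) := by
    by_cases h : (shear a f).coeff f.totalDegree = 0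
    · simp [h]
    · have h1 := totalDegree_coeff_add_le_jointDegree _ h
      have h2 := jointDegree_shear_le a f
      have h3 := totalDegree_eq_zero_iff_eq_C.1
        (show ((shear a f).coeff f.totalDegree).totalDegree = 0 by omega)
      rw [h3]; simp
  have hev : (shear a f).map (eval 0) =
      aeval (fun v : Option σ => Polynomial.C (v.elim 1 a) * Polynomial.X) f := by
    have : (Polynomial.mapAlgHom (aeval (0 : σ → K))).comp (shear a) =
        aeval (fun v : Option σ => Polynomial.C (v.elim 1 a) * Polynomial.X) := by
      ext v : 1
      cases v <;> simp [shear]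
    exact DFunLike.congr_fun this f
  rw [hconst, ← Polynomial.coeff_map, hev, coeff_aeval_C_mul_X]
  congr 1
  have : (aeval a).comp (aeval fun v : Option σ => v.elim (1 : MvPolynomial σ K) X) =
      aeval (fun v : Option σ => v.elim 1 a) := by
    ext v : 1
    cases v <;> simp
  exact (DFunLike.congr_fun this (homogeneousComponent f.totalDegree f)).symm

end Shear

/-! ### Restriction to generic planes -/

section Plane

variable {K : Type*} [Field K] {n : ℕ}

/-- The ring homomorphism `K[x₁, …, xₙ] → K[x]` restricting to the line through `0` and `b`. -/
noncomputable def lineRestriction (b : Fin n → K) :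
    MvPolynomial (Fin n) K →ₐ[K] Polynomial K :=
  aeval fun i => Polynomial.C (b i) * Polynomial.X

theorem eval_zero_lineRestriction (b : Fin n → K) (q : MvPolynomial (Fin n) K) :
    (lineRestriction b q).eval 0 = eval 0 q := by
  have : (Polynomial.aeval (0 : K)).comp (lineRestriction b) = aeval (0 : Fin n → K) := by
    ext i; simp [lineRestriction]
  exact DFunLike.congr_fun this q

theorem eval_one_lineRestriction (b : Fin n → K) (q : MvPolynomial (Fin n) K) :
    (lineRestriction b q).eval 1 = eval b q := by
  have : (Polynomial.aeval (1 : K)).comp (lineRestriction b) = aeval b := by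
    ext i; simp [lineRestriction]
  exact DFunLike.congr_fun this q

/-- The identification of `K[x, y]` with `K[x][y]`. -/
noncomputable def planeToIterated (K : Type*) [Field K] :
    MvPolynomial (Fin 2) K →ₐ[K] Polynomial (Polynomial K) :=
  aeval ![Polynomial.C Polynomial.X, Polynomial.X]

theorem planeToIterated_planeRestriction (a b : Fin n → K) (f : PolyXY K n) :
    planeToIterated K (planeRestriction a b f) =
      (shear a f).map (lineRestriction b : MvPolynomial (Fin n) K →+* Polynomial K) := by
  have : (planeToIterated K).comp (aeval (fun v : Option (Fin n) =>
      match v with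
      | some i => C (b i) * X 0 + C (a i) * X 1
      | none => X 1)) = (Polynomial.mapAlgHom (lineRestriction b)).comp (shear a) := by
    ext v : 1
    cases v <;> simp [planeToIterated, shear, lineRestriction]
  exact DFunLike.congr_fun this f

/-- A nonconstant element of `K[x₁, …, xₙ][y]` stays nonconstant on planes `(b x, y)` for
generic `b`. -/
theorem exists_eval_ne_zero_imp_not_const {D : ℕ} (c : Polynomial (MvPolynomial (Fin n) K))
    (hD : jointDegree c ≤ D)
    (hc : ¬ ∃ k : K, c = algebraMap K (Polynomial (MvPolynomial (Fin n) K)) k) :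
    ∃ P : MvPolynomial (Fin n) K, P ≠ 0 ∧ P.totalDegree ≤ D ∧ ∀ b, eval b P ≠ 0 →
      ¬ ∃ k : K, c.map (lineRestriction b : MvPolynomial (Fin n) K →+* Polynomial K) =
        algebraMap K (Polynomial (Polynomial K)) k := by
  have hcoeffD : ∀ j, (c.coeff j).totalDegree ≤ D := by
    intro j
    by_cases h : c.coeff j = 0
    · simp [h]
    · have := totalDegree_coeff_add_le_jointDegree c h
      omega
  by_cases hj : ∃ j, 0 < j ∧ c.coeff j ≠ 0
  · obtain ⟨j, hj0, hj⟩ := hj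
    refine ⟨c.coeff j, hj, hcoeffD j, fun b hb => ?_⟩
    rintro ⟨k, hk⟩
    apply hb
    have h := congrArg (fun P => (Polynomial.coeff P j).eval 1) hk
    simp only [Polynomial.coeff_map, RingHom.coe_coe, eval_one_lineRestriction] at h
    rw [h, IsScalarTower.algebraMap_apply K (Polynomial K), Polynomial.algebraMap_eq,
      Polynomial.coeff_C_of_ne_zero hj0.ne', Polynomial.eval_zero]
  · push Not at hj
    -- Here c is free of y; a constant restriction to the line would take equal values at its points
    -- 0 and b.
    refine ⟨c.coeff 0 - C (eval 0 (c.coeff 0)), ?_, ?_, fun b hb => ?_⟩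
    · intro h0
      refine hc ⟨eval 0 (c.coeff 0), ?_⟩
      rw [IsScalarTower.algebraMap_apply K (MvPolynomial (Fin n) K), algebraMap_eq,
        ← sub_eq_zero.1 h0]
      ext1 j
      rcases Nat.eq_zero_or_pos j with rfl | hj0
      · simp
      · rw [hj j hj0, Polynomial.algebraMap_eq, Polynomial.coeff_C_of_ne_zero hj0.ne']
    · exact (totalDegree_sub_C_le _ _).trans (hcoeffD 0)
    · rintro ⟨k, hk⟩
      apply hb
      have h1 := congrArg (fun P => (Polynomial.coeff P 0).eval 1) hk
      have h0 := congrArg (fun P => (Polynomial.coeff P 0).eval 0) hk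
      rw [IsScalarTower.algebraMap_apply K (Polynomial K), Polynomial.algebraMap_eq,
        Polynomial.algebraMap_eq] at h1 h0
      simp only [Polynomial.coeff_map, RingHom.coe_coe, eval_one_lineRestriction,
        eval_zero_lineRestriction, Polynomial.coeff_C_zero, Polynomial.eval_C] at h1 h0
      rw [map_sub, eval_C, h1, h0, sub_self]

/-- Decompositions with an inner polynomial of given degree are avoided on generic planes. -/
theorem exists_eval_ne_zero_imp_inner_degree_ne {a : Fin n → K} {f : PolyXY K n}
    (hL : eval a (dehomogenizedTop f) ≠ 0) (hf : ¬ IsDecomposable f)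
    (hK : ∀ r, 0 < r → r ≤ f.totalDegree → (r : K) ≠ 0)
    {s : ℕ} (hs : 0 < s) (hsf : s < f.totalDegree) :
    ∃ P : MvPolynomial (Fin n) K, P ≠ 0 ∧ P.totalDegree ≤ f.totalDegree ∧ ∀ b, eval b P ≠ 0 →
      ∀ (g : Polynomial K) (h : Polynomial (Polynomial K)), 2 ≤ g.natDegree →
        planeToIterated K (planeRestriction a b f) = Polynomial.aeval h g → h.natDegree ≠ s := by
  obtain ⟨e, he⟩ : ∃ e, e = f.totalDegree := ⟨_, rfl⟩
  rw [← he] at hK hsf ⊢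
  let u := eval a (dehomogenizedTop f)
  let F : Polynomial (MvPolynomial (Fin n) K) := Polynomial.C (C u⁻¹) * shear a f
  have hcoeff : (shear a f).coeff e = C u := by rw [he]; exact coeff_shear_totalDegree a f
  have hFle : F.natDegree ≤ e :=
    (Polynomial.natDegree_C_mul_le _ _).trans (he ▸ natDegree_shear_le a f)
  have hFc : F.coeff e = 1 := by
    rw [Polynomial.coeff_C_mul, hcoeff, ← C_mul, inv_mul_cancel₀ hL, C_1]
  have hFm : F.Monic := Polynomial.monic_of_natDegree_le_of_coeff_eq_one e hFle hFc
  have hFd : F.natDegree = e :=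
    le_antisymm hFle (Polynomial.le_natDegree_of_ne_zero (by rw [hFc]; exact one_ne_zero))
  have hFj : jointDegree F ≤ e := by
    refine (jointDegree_mul_le _ _).trans ?_
    have h1 := jointDegree_C_le (σ := Fin n) (C u⁻¹ : MvPolynomial (Fin n) K)
    have h2 := jointDegree_shear_le a f
    rw [totalDegree_C] at h1
    omega
  -- The monic normalisation of a decomposition on the plane.
  have hplane : ∀ (b : Fin n → K) (g : Polynomial K) (h : Polynomial (Polynomial K)),
      2 ≤ g.natDegree → planeToIterated K (planeRestriction a b f) = Polynomial.aeval h g →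
      e = g.natDegree * h.natDegree ∧ ∃ (h₁ : Polynomial (Polynomial K)) (g₁ : Polynomial K),
        h₁.Monic ∧ h₁.natDegree = h.natDegree ∧
        F.map (lineRestriction b : MvPolynomial (Fin n) K →+* Polynomial K) =
          Polynomial.aeval h₁ g₁ ∧
        (F.map (lineRestriction b : MvPolynomial (Fin n) K →+* Polynomial K) -
          h₁ ^ g.natDegree).degree < ((g.natDegree - 1) * h.natDegree : ℕ) := by
    intro b g h hg hgh
    have hmap : F.map (lineRestriction b : MvPolynomial (Fin n) K →+* Polynomial K) =
        Polynomial.aeval h (Polynomial.C u⁻¹ * g) := by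
      rw [Polynomial.map_mul, ← planeToIterated_planeRestriction, hgh, map_mul,
        Polynomial.aeval_C]
      congr 1
      rw [Polynomial.map_C, ← algebraMap_eq, RingHom.coe_coe, AlgHom.commutes]
      rfl
    have hgd : (Polynomial.C u⁻¹ * g).natDegree = g.natDegree :=
      Polynomial.natDegree_C_mul (inv_ne_zero hL)
    have hmapd : (F.map (lineRestriction b : MvPolynomial (Fin n) K →+* Polynomial K)).natDegree
        = e := by rw [hFm.natDegree_map, hFd]
    have hle : g.natDegree ≤ e ∧ 0 < g.natDegree := by
      have hd := hmapd
      rw [hmap, natDegree_aeval, hgd] at hd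
      refine ⟨?_, by omega⟩
      rw [← hd]
      refine Nat.le_mul_of_pos_right _ (Nat.pos_of_ne_zero fun h0 => ?_)
      rw [h0] at hd
      omega
    have := exists_normalized_decomposition (K := K) (A := Polynomial K) (h := h)
      (fun p hp => by
        obtain ⟨c, _, hc⟩ := Polynomial.isUnit_iff.1 hp
        exact ⟨c, hc.symm⟩) (hFm.map _) (by rw [hmapd]; omega) (by rw [hgd]; exact hg)
      (by rw [hgd]; exact hK _ hle.2 hle.1) hmap
    rwa [hgd, hmapd] at this
  by_cases hdvd : s ∣ e
  · obtain ⟨r, hr⟩ := hdvd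
    rw [mul_comm] at hr
    have hr2 : 2 ≤ r := by
      by_contra hlt
      have : r ≤ 1 := by omega
      have := Nat.mul_le_mul_right s this
      omega
    have hre : r ≤ e := by rw [hr]; exact Nat.le_mul_of_pos_right r hs
    have hrK := hK r (by omega) hre
    obtain ⟨H, hHm, hHd, hHj, hHF⟩ := exists_approximateRoot (by omega) hrK hFm
      (hFd.trans hr) (hFj.trans hr.le)
    -- If all digits were constant, F would be a polynomial in H of degree r ≥ 2, and undoing the
    -- shear would decompose f.
    have hdig : ∃ i, ¬ ∃ k : K, adicDigit H F i =
        algebraMap K (Polynomial (MvPolynomial (Fin n) K)) k := by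
      by_contra hall
      push Not at hall
      obtain ⟨g, hg⟩ := exists_eq_aeval_of_adicDigit hHm (by omega) F hall
      have hgr : g.natDegree = r := by
        rw [hr, hg, natDegree_aeval, hHd] at hFd
        exact Nat.eq_of_mul_eq_mul_right hs hFd
      refine hf (isDecomposable_of_shear (a := a) (h := H) (g := Polynomial.C u * g) ?_ ?_)
      · rw [Polynomial.natDegree_C_mul hL, hgr]
        exact hr2
      · rw [map_mul, ← hg, Polynomial.aeval_C, IsScalarTower.algebraMap_apply K
          (MvPolynomial (Fin n) K), algebraMap_eq, Polynomial.algebraMap_eq, ← mul_assoc,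
          ← Polynomial.C_mul, ← C_mul, mul_inv_cancel₀ hL, C_1, Polynomial.C_1, one_mul]
    obtain ⟨i, hi⟩ := hdig
    obtain ⟨P, hP0, hPd, hP⟩ := exists_eval_ne_zero_imp_not_const _
      (jointDegree_adicDigit_le hHm (by omega) F hFj i) hi
    refine ⟨P, hP0, hPd, fun b hb g h hg hgh hhs => hP b hb ?_⟩
    obtain ⟨heq, h₁, g₁, h₁m, h₁d, hFg, hdeg⟩ := hplane b g h hg hgh
    have hgr : g.natDegree = r := by
      rw [hhs, hr] at heq
      exact (Nat.eq_of_mul_eq_mul_right hs heq).symm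
    rw [hgr, hhs] at hdeg
    have hrA : (r : Polynomial K) ≠ 0 := by
      rw [← map_natCast (Polynomial.C : K →+* Polynomial K)]
      exact Polynomial.C_ne_zero.2 hrK
    -- By uniqueness, approximate roots commute with restriction to the line.
    have hH : H.map (lineRestriction b : MvPolynomial (Fin n) K →+* Polynomial K) = h₁ := by
      refine approximateRoot_unique (r := r) (s := s) hrA (hHm.map _) h₁m
        (by rw [hHm.natDegree_map, hHd]) (h₁d.trans hhs) ?_ hdeg
      rw [← Polynomial.map_pow, ← Polynomial.map_sub]
      exact lt_of_le_of_lt Polynomial.degree_map_le hHF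
    rw [map_adicDigit _ hHm, hH, hFg]
    exact adicDigit_aeval h₁m (by omega) g₁ i
  -- An inner degree always divides e, so nothing has to be avoided.
  · refine ⟨1, one_ne_zero, by simp, fun b _ g h hg hgh hhs => hdvd ?_⟩
    rw [← hhs, (hplane b g h hg hgh).1]
    exact Dvd.intro_left _ rfl

/-- For generic `b`, the restriction of an indecomposable polynomial stays indecomposable. -/
theorem exists_forall_eval_ne_zero_imp_isIndecomposable {a : Fin n → K} {f : PolyXY K n}
    (hL : eval a (dehomogenizedTop f) ≠ 0) (hf : IsIndecomposable f)
    (hK : ∀ r, 0 < r → r ≤ f.totalDegree → (r : K) ≠ 0) :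
    ∃ P : ℕ → MvPolynomial (Fin n) K,
      (∀ s, P s ≠ 0 ∧ (P s).totalDegree ≤ f.totalDegree) ∧
      ∀ b, (∀ s ∈ Finset.Ico 1 f.totalDegree, eval b (P s) ≠ 0) →
        IsIndecomposable (planeRestriction a b f) := by
  have hex : ∀ s, ∃ P : MvPolynomial (Fin n) K, P ≠ 0 ∧ P.totalDegree ≤ f.totalDegree ∧
      (s ∈ Finset.Ico 1 f.totalDegree → ∀ b, eval b P ≠ 0 →
      ∀ (g : Polynomial K) (h : Polynomial (Polynomial K)), 2 ≤ g.natDegree →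
        planeToIterated K (planeRestriction a b f) = Polynomial.aeval h g →
          h.natDegree ≠ s) := by
    intro s
    by_cases hs : s ∈ Finset.Ico 1 f.totalDegree
    · obtain ⟨h1, h2⟩ := Finset.mem_Ico.1 hs
      obtain ⟨P, hP0, hPd, hP⟩ := exists_eval_ne_zero_imp_inner_degree_ne hL hf.2 hK h1 h2
      exact ⟨P, hP0, hPd, fun _ => hP⟩
    · exact ⟨1, one_ne_zero, by simp, fun h => absurd h hs⟩
  choose P hP0 hPd hP using hex
  have hpos : 0 < f.totalDegree := by
    rw [Nat.pos_iff_ne_zero]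
    intro h0
    exact hf.1 _ (totalDegree_eq_zero_iff_eq_C.1 h0)
  refine ⟨P, fun s => ⟨hP0 s, hPd s⟩, fun b hb => ?_⟩
  have hd : (planeToIterated K (planeRestriction a b f)).natDegree = f.totalDegree := by
    rw [planeToIterated_planeRestriction]
    refine le_antisymm (Polynomial.natDegree_map_le.trans (natDegree_shear_le a f))
      (Polynomial.le_natDegree_of_ne_zero ?_)
    rw [Polynomial.coeff_map, coeff_shear_totalDegree, ← algebraMap_eq, RingHom.coe_coe,
      AlgHom.commutes]
    exact (map_ne_zero _).2 hL
  constructor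
  · intro c hc
    rw [hc, planeToIterated, algHom_C] at hd
    rw [IsScalarTower.algebraMap_apply K (Polynomial K), Polynomial.algebraMap_eq,
      Polynomial.natDegree_C] at hd
    omega
  · rintro ⟨g, h, hg, hgh⟩
    have hgh' := congrArg (planeToIterated K) hgh
    rw [← Polynomial.aeval_algHom_apply] at hgh'
    have hmul : f.totalDegree = g.natDegree * (planeToIterated K h).natDegree := by
      rw [← hd, hgh', natDegree_aeval]
    have hmem : (planeToIterated K h).natDegree ∈ Finset.Ico 1 f.totalDegree := by
      have h0 : 0 < (planeToIterated K h).natDegree := by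
        refine Nat.pos_of_ne_zero fun h0 => ?_
        rw [h0] at hmul
        omega
      have := Nat.mul_le_mul_right (planeToIterated K h).natDegree hg
      rw [Finset.mem_Ico]
      omega
    exact hP _ hmem b (hb _ hmem) g _ hg hgh' rfl

end Plane

/-! ### Union bounds -/

section Probability

theorem uniformPr_not {S : Type*} [Finite S] [Nonempty S] (P : S → Prop) :
    uniformPr S (fun s => ¬ P s) = 1 - uniformPr S P := by
  classical
  have := Fintype.ofFinite S
  have hc : (Fintype.card {s // ¬ P s} : ℝ) = Fintype.card S - Fintype.card {s // P s} := by
    rw [Fintype.card_subtype_compl, Nat.cast_sub (Fintype.card_subtype_le _)]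
  have h0 : (Fintype.card S : ℝ) ≠ 0 := by exact_mod_cast Fintype.card_ne_zero
  simp only [uniformPr, Nat.card_eq_fintype_card, hc]
  field_simp

theorem uniformPr_mono {S : Type*} [Finite S] [Nonempty S] {P Q : S → Prop}
    (h : ∀ s, P s → Q s) : uniformPr S P ≤ uniformPr S Q := by
  unfold uniformPr
  gcongr
  exact Nat.card_le_card_of_injective _ (Subtype.map_injective (f := id) h Function.injective_id)

theorem uniformPr_nonneg {S : Type*} [Finite S] [Nonempty S] (P : S → Prop) :
    0 ≤ uniformPr S P := by
  unfold uniformPr; positivity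

theorem uniformPr_exists_le {S ι : Type*} [Finite S] [Nonempty S] (I : Finset ι)
    (P : ι → S → Prop) {δ : ℝ} (h : ∀ i ∈ I, uniformPr S (P i) ≤ δ) :
    uniformPr S (fun s => ∃ i ∈ I, P i s) ≤ I.card * δ := by
  classical
  have := Fintype.ofFinite S
  have hN : (0 : ℝ) < Fintype.card S := by exact_mod_cast Fintype.card_pos
  rw [← nsmul_eq_mul]
  refine le_trans ?_ (Finset.sum_le_card_nsmul I (fun i => uniformPr S (P i)) δ h)
  simp only [uniformPr, Nat.card_eq_fintype_card, Fintype.card_subtype]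
  rw [← Finset.sum_div]
  gcongr
  rw [← Nat.cast_sum, Nat.cast_le]
  refine le_trans (Finset.card_le_card ?_) Finset.card_biUnion_le
  intro s hs
  simpa using hs

/-- Union bound over two independent choices. -/
theorem uniformPr_prod_le {T : Type*} [Finite T] [Nonempty T] {A : T → Prop}
    {B : T → T → Prop} {α β : ℝ} (hβ : 0 ≤ β) (hA : uniformPr T A ≤ α)
    (hB : ∀ r, ¬ A r → uniformPr T (B r) ≤ β) :
    uniformPr (T × T) (fun rs => A rs.1 ∨ B rs.1 rs.2) ≤ α + β := by
  classical
  have := Fintype.ofFinite T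
  have hN : (0 : ℝ) < Fintype.card T := by exact_mod_cast Fintype.card_pos
  simp only [uniformPr, Nat.card_eq_fintype_card, Fintype.card_prod, Nat.cast_mul,
    Fintype.card_subtype] at hA hB ⊢
  rw [div_le_iff₀ hN] at hA
  rw [div_le_iff₀ (by positivity)]
  have hcard : (Finset.univ.filter fun rs : T × T => A rs.1 ∨ B rs.1 rs.2).card =
      ∑ r, (Finset.univ.filter fun t => A r ∨ B r t).card := by
    simp only [Finset.card_filter, Fintype.sum_prod_type]
  have hr : ∀ r, ((Finset.univ.filter fun t => A r ∨ B r t).card : ℝ) ≤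
      (if A r then 1 else 0) * Fintype.card T + β * Fintype.card T := by
    intro r
    by_cases h : A r
    · simp only [h, true_or, if_true, Finset.filter_true, Finset.card_univ, one_mul]
      exact le_add_of_nonneg_right (by positivity)
    · have := hB r h
      rw [div_le_iff₀ hN] at this
      simpa only [h, false_or, if_false, zero_mul, zero_add] using this
  rw [hcard, Nat.cast_sum]
  refine (Finset.sum_le_sum fun r _ => hr r).trans ?_
  rw [Finset.sum_add_distrib, ← Finset.sum_mul, Finset.sum_boole, Finset.sum_const,
    Finset.card_univ, nsmul_eq_mul]
  nlinarith

end Probability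

/-! ### The probability estimate -/

theorem IsHSG.nonneg {K T : Type*} [Field K] [Finite T] [Nonempty T] {n : ℕ}
    {H : T → Fin n → K} {D : ℕ} {δ : ℝ} (hH : IsHSG H D δ) : 0 ≤ δ :=
  (uniformPr_nonneg _).trans (hH 1 one_ne_zero (by simp))

/-- The characteristic exceeds d: for d ≥ 2 because d(d - 1) + 1 > d, for d = 1 because it is not 1.
-/
theorem natCast_ne_zero_of_le {K : Type*} [Field K] [Finite K] {d : ℕ}
    (hchar : d * (d - 1) + 1 ≤ ringChar K) {r : ℕ} (hr : 0 < r) (hrd : r ≤ d) :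
    (r : K) ≠ 0 := by
  intro h0
  have hdvd := (ringChar.spec K r).1 h0
  have hle := Nat.le_of_dvd hr hdvd
  have h1 : ringChar K ≠ 1 := CharP.ringChar_ne_one
  obtain ⟨m, rfl⟩ : ∃ m, d = m + 1 := ⟨d - 1, by omega⟩
  rw [Nat.add_sub_cancel] at hchar
  rcases Nat.eq_zero_or_pos m with rfl | hm
  · omega
  · nlinarith

theorem lemma5p1 {𝔽 T : Type*} [Field 𝔽] [Finite 𝔽] [Finite T] [Nonempty T]
    (n d : ℕ) (hn : 0 < n) (hd : 0 < d) (hchar : d * (d - 1) + 1 ≤ ringChar 𝔽)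
    (δ : ℝ) (H : T → Fin n → 𝔽) (hH : IsHSG H (2 * d - 1) δ)
    (f : PolyXY 𝔽 n) (hdeg : f.totalDegree ≤ d) (hf : IsIndecomposable f) :
    1 - 2 ^ (d - 1) * δ ≤
      uniformPr (T × T)
        (fun rs => IsIndecomposable (planeRestriction (H rs.1) (H rs.2) f)) := by
  have hδ := hH.nonneg
  have hf0 : f ≠ 0 := fun h => hf.1 0 (by rw [h, C_0])
  let A : T → Prop := fun r => eval (H r) (dehomogenizedTop f) = 0
  have hA : uniformPr T A ≤ δ := hH _ (dehomogenizedTop_ne_zero hf0)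
    ((totalDegree_dehomogenizedTop_le f).trans (by omega))
  have hex : ∀ r, ∃ P : ℕ → MvPolynomial (Fin n) 𝔽, ¬ A r →
      (∀ s, P s ≠ 0 ∧ (P s).totalDegree ≤ f.totalDegree) ∧
      ∀ b, (∀ s ∈ Finset.Ico 1 f.totalDegree, eval b (P s) ≠ 0) →
        IsIndecomposable (planeRestriction (H r) b f) := by
    intro r
    by_cases hr : A r
    · exact ⟨0, fun h => absurd hr h⟩
    · obtain ⟨P, hP⟩ := exists_forall_eval_ne_zero_imp_isIndecomposable hr hf
        fun k hk hkf => natCast_ne_zero_of_le hchar hk (hkf.trans hdeg)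
      exact ⟨P, fun _ => hP⟩
  choose P hP using hex
  let B : T → T → Prop := fun r t => ∃ s ∈ Finset.Ico 1 f.totalDegree, eval (H t) (P r s) = 0
  have hB : ∀ r, ¬ A r → uniformPr T (B r) ≤ ((f.totalDegree - 1 : ℕ) : ℝ) * δ := by
    intro r hr
    rw [← Nat.card_Ico 1 f.totalDegree]
    exact uniformPr_exists_le _ _ fun s _ => hH _ ((hP r hr).1 s).1
      (((hP r hr).1 s).2.trans (by omega))
  have hbad : uniformPr (T × T)
      (fun rs => ¬ IsIndecomposable (planeRestriction (H rs.1) (H rs.2) f)) ≤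
        δ + ((f.totalDegree - 1 : ℕ) : ℝ) * δ := by
    refine le_trans (uniformPr_mono fun rs hrs => ?_)
      (uniformPr_prod_le (by positivity) hA hB)
    by_contra hAB
    rw [not_or] at hAB
    refine hrs ((hP rs.1 hAB.1).2 (H rs.2) fun s hs h0 => hAB.2 ⟨s, hs, h0⟩)
  rw [uniformPr_not] at hbad
  -- The count of bad events is linear in the degree; the exponential bound is reached through d ≤
  -- 2^(d-1).
  have hpow : (1 + ((f.totalDegree - 1 : ℕ) : ℝ)) ≤ 2 ^ (d - 1) := by
    have h1 : d - 1 < 2 ^ (d - 1) := Nat.lt_two_pow_self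
    have h2 : 1 + (f.totalDegree - 1) ≤ 2 ^ (d - 1) := by omega
    exact_mod_cast h2
  nlinarith [mul_le_mul_of_nonneg_right hpow hδ]
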